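/- Let $\langle\mathcal C,\Box,e\rangle$ be a monoidal category such that $\mathcal C$ is complete, well-powered and has a small cogenerating set. Let $\langle\mathcal M,\otimes,i\rangle$ be a monoidal category which has coequalizers and in which $x\otimes-$ and $-\otimes x$ preserve coequalizers for every object $x$; both categories are locally small. Let $\langle G,G_2,G_0\rangle\colon\mathcal C\to\mathcal M$ be a (lax) monoidal functor whose underlying functor has a left adjoint. Let $R$ be the monoid in $\mathcal M$ with underlying object $Ge$, multiplication $G\mathbf l_e\circ G_{e,e}$ and unit $G_0$. For a monoid $R$ in $\mathcal M$ let ${}_R\mathcal M_R$ be the monoidal category of $R$-$R$-bimodules in $\mathcal M$, with tensor product the coequalizer $x\otimes_R y$ of the two arrows $x\otimes R\otimes y\rightrightarrows x\otimes y$, and let $\Gamma\colon{}_R\mathcal M_R\to\mathcal M$ be the forgetful functor, which is monoidal via the coequalizers $x\otimes y\to x\otimes_R y$ and the unit $i\to R$. Let $U\colon\mathcal C\to{}_R\mathcal M_R$ be the canonical monoidal functor with $G=\Gamma U$ as monoidal functors: $Uc$ is $Gc$ with left action $G\mathbf l_c\circ G_{e,c}$ and right action $G\mathbf r_c\circ G_{c,e}$,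 $U_{a,b}\colon Ga\otimes_R Gb\to G(a\Box b)$ is induced by $G_{a,b}$, and $U_0$ is the identity of $R$. Assume that $G$ is essentially strong monoidal, i.e. that $U$ is strong monoidal (all $U_{a,b}$ and $U_0$ are isomorphisms). Then $U$ has a left adjoint $F$, and the monad $\mathtt T=UF$ of the adjunction on ${}_R\mathcal M_R$ carries the structure of an opmonoidal monad (its underlying functor is opmonoidal, and its multiplication and unit are opmonoidal natural transformations) and the comparison functor $K\colon\mathcal C\to({}_R\mathcal M_R)^{\mathtt T}$, $c\mapsto\langle Uc,U\varepsilon_c\rangle$, carries a strong monoidal structure, such that $$G=\Gamma\circ U^{\mathtt T}\circ K$$ as monoidal functors, i.e. the composite $$\mathcal C\xrightarrow{\;K\;}({}_R\mathcal M_R)^{\mathtt T}\xrightarrow{\;U^{\mathtt T}\;}{}_R\mathcal M_R\xrightarrow{\;\Gamma\;}\mathcal M$$ equals $G$, including the structure arrows $G_2$ and $G_0$. Here the Eilenberg–Moore category $({}_R\mathcal M_R)^{\mathtt T}$ has the monoidal structure for which the forgetful functor $U^{\mathtt T}$ is strict monoidal: the $\mathtt T$-action on $\langle x,\alpha\rangle\otimes\langle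 y,\beta\rangle$ is $(\alpha\otimes_R\beta)\circ T_{x,y}\colon T(x\otimes_R y)\to x\otimes_R y$, and the unit is $R$ with action $T_0\colon TR\to R$. -/

import Mathlib

set_option linter.unusedSectionVars false

open CategoryTheory CategoryTheory.Limits CategoryTheory.MonoidalCategory

universe v u₁ u₂

noncomputable section

namespace BimodTensor

open MonObj

variable {M : Type u₂} [Category.{v} M] [MonoidalCategory M] [HasCoequalizers M] {R : Mon M}

/-- The underlying object of `P ⊗_R Q`. -/
def obj (P Q : Bimod R R) : M :=
  coequalizer (P.actRight ▷ Q.X) ((α_ P.X R.X Q.X).hom ≫ P.X ◁ Q.actLeft)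

/-- The canonical projection `P ⊗ Q ⟶ P ⊗_R Q`. -/
def proj (P Q : Bimod R R) : P.X ⊗ Q.X ⟶ obj P Q :=
  coequalizer.π (P.actRight ▷ Q.X) ((α_ P.X R.X Q.X).hom ≫ P.X ◁ Q.actLeft)

lemma proj_condition (P Q : Bimod R R) :
    P.actRight ▷ Q.X ≫ proj P Q = (α_ P.X R.X Q.X).hom ≫ P.X ◁ Q.actLeft ≫ proj P Q :=
  (coequalizer.condition (P.actRight ▷ Q.X) ((α_ P.X R.X Q.X).hom ≫ P.X ◁ Q.actLeft)).trans
    (Category.assoc _ _ _)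

lemma proj_condition_assoc (P Q : Bimod R R) {Z : M} (h : obj P Q ⟶ Z) :
    P.actRight ▷ Q.X ≫ proj P Q ≫ h =
      (α_ P.X R.X Q.X).hom ≫ P.X ◁ Q.actLeft ≫ proj P Q ≫ h := by
  rw [← Category.assoc, proj_condition]
  simp only [Category.assoc]

/-- The image of a chosen coequalizer under a functor preserving coequalizers is epi. -/
lemma epi_map_proj (H : M ⥤ M) [PreservesColimitsOfShape WalkingParallelPair H]
    (P Q : Bimod R R) : Epi (H.map (proj P Q)) :=
  inferInstanceAs (Epi (H.map (coequalizer.π (P.actRight ▷ Q.X)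
    ((α_ P.X R.X Q.X).hom ≫ P.X ◁ Q.actLeft))))

instance (P Q : Bimod R R) : Epi (proj P Q) :=
  inferInstanceAs (Epi (coequalizer.π (P.actRight ▷ Q.X)
    ((α_ P.X R.X Q.X).hom ≫ P.X ◁ Q.actLeft)))

/-- Arrows out of `P ⊗_R Q` induced by balanced arrows out of `P ⊗ Q`. -/
def desc {P Q : Bimod R R} {Z : M} (f : P.X ⊗ Q.X ⟶ Z)
    (h : P.actRight ▷ Q.X ≫ f = (α_ P.X R.X Q.X).hom ≫ P.X ◁ Q.actLeft ≫ f) : obj P Q ⟶ Z :=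
  coequalizer.desc f (by simpa using h)

@[simp] lemma proj_desc {P Q : Bimod R R} {Z : M} (f : P.X ⊗ Q.X ⟶ Z)
    (h : P.actRight ▷ Q.X ≫ f = (α_ P.X R.X Q.X).hom ≫ P.X ◁ Q.actLeft ≫ f) :
    proj P Q ≫ desc f h = f :=
  coequalizer.π_desc _ _

@[simp] lemma proj_desc_assoc {P Q : Bimod R R} {Z Z' : M} (f : P.X ⊗ Q.X ⟶ Z)
    (h : P.actRight ▷ Q.X ≫ f = (α_ P.X R.X Q.X).hom ≫ P.X ◁ Q.actLeft ≫ f) (g : Z ⟶ Z') :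
    proj P Q ≫ desc f h ≫ g = f ≫ g := by
  rw [← Category.assoc, proj_desc]

variable [∀ X : M, PreservesColimitsOfShape WalkingParallelPair (tensorLeft X)]
variable [∀ X : M, PreservesColimitsOfShape WalkingParallelPair (tensorRight X)]

instance epi_whiskerLeft_proj (W : M) (P Q : Bimod R R) : Epi (W ◁ proj P Q) :=
  epi_map_proj (tensorLeft W) P Q

instance epi_proj_whiskerRight (P Q : Bimod R R) (W : M) : Epi (proj P Q ▷ W) :=
  epi_map_proj (tensorRight W) P Q

instance epi_whiskerLeft_whiskerLeft_proj (V W : M) (P Q : Bimod R R) :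
    Epi (V ◁ W ◁ proj P Q) :=
  epi_map_proj (tensorLeft W ⋙ tensorLeft V) P Q

instance epi_whiskerLeft_proj_whiskerRight (V W : M) (P Q : Bimod R R) :
    Epi (V ◁ proj P Q ▷ W) :=
  epi_map_proj (tensorRight W ⋙ tensorLeft V) P Q

instance epi_proj_whiskerRight_whiskerRight (P Q : Bimod R R) (V W : M) :
    Epi (proj P Q ▷ V ▷ W) :=
  epi_map_proj (tensorRight V ⋙ tensorRight W) P Q

instance epi_whiskerLeft_proj_whiskerRight' (V W : M) (P Q : Bimod R R) :
    Epi ((V ◁ proj P Q) ▷ W) :=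
  epi_map_proj (tensorLeft V ⋙ tensorRight W) P Q

/-- Arrows out of `W ⊗ (P ⊗_R Q)` induced by balanced arrows out of `W ⊗ (P ⊗ Q)`. -/
def descL {P Q : Bimod R R} {W Z : M} (f : W ⊗ P.X ⊗ Q.X ⟶ Z)
    (h : W ◁ P.actRight ▷ Q.X ≫ f = W ◁ (α_ P.X R.X Q.X).hom ≫ W ◁ P.X ◁ Q.actLeft ≫ f) :
    W ⊗ obj P Q ⟶ Z :=
  (PreservesCoequalizer.iso (tensorLeft W) (P.actRight ▷ Q.X)
    ((α_ P.X R.X Q.X).hom ≫ P.X ◁ Q.actLeft)).inv ≫ coequalizer.desc f (by simpa using h)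

@[simp] lemma proj_descL {P Q : Bimod R R} {W Z : M} (f : W ⊗ P.X ⊗ Q.X ⟶ Z)
    (h : W ◁ P.actRight ▷ Q.X ≫ f = W ◁ (α_ P.X R.X Q.X).hom ≫ W ◁ P.X ◁ Q.actLeft ≫ f) :
    W ◁ proj P Q ≫ descL f h = f :=
  map_π_preserves_coequalizer_inv_desc (tensorLeft W) _ _ f (by simpa using h)

@[simp] lemma proj_descL_assoc {P Q : Bimod R R} {W Z Z' : M} (f : W ⊗ P.X ⊗ Q.X ⟶ Z)
    (h : W ◁ P.actRight ▷ Q.X ≫ f = W ◁ (α_ P.X R.X Q.X).hom ≫ W ◁ P.X ◁ Q.actLeft ≫ f)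
    (g : Z ⟶ Z') : W ◁ proj P Q ≫ descL f h ≫ g = f ≫ g := by
  rw [← Category.assoc, proj_descL]

/-- Arrows out of `(P ⊗_R Q) ⊗ W` induced by balanced arrows out of `(P ⊗ Q) ⊗ W`. -/
def descR {P Q : Bimod R R} {W Z : M} (f : (P.X ⊗ Q.X) ⊗ W ⟶ Z)
    (h : P.actRight ▷ Q.X ▷ W ≫ f = (α_ P.X R.X Q.X).hom ▷ W ≫ (P.X ◁ Q.actLeft) ▷ W ≫ f) :
    obj P Q ⊗ W ⟶ Z :=
  (PreservesCoequalizer.iso (tensorRight W) (P.actRight ▷ Q.X)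
    ((α_ P.X R.X Q.X).hom ≫ P.X ◁ Q.actLeft)).inv ≫
      coequalizer.desc f (by simpa [-whisker_assoc] using h)

@[simp] lemma proj_descR {P Q : Bimod R R} {W Z : M} (f : (P.X ⊗ Q.X) ⊗ W ⟶ Z)
    (h : P.actRight ▷ Q.X ▷ W ≫ f = (α_ P.X R.X Q.X).hom ▷ W ≫ (P.X ◁ Q.actLeft) ▷ W ≫ f) :
    proj P Q ▷ W ≫ descR f h = f :=
  map_π_preserves_coequalizer_inv_desc (tensorRight W) _ _ f (by simpa [-whisker_assoc] using h)

@[simp] lemma proj_descR_assoc {P Q : Bimod R R} {W Z Z' : M} (f : (P.X ⊗ Q.X) ⊗ W ⟶ Z)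
    (h : P.actRight ▷ Q.X ▷ W ≫ f = (α_ P.X R.X Q.X).hom ▷ W ≫ (P.X ◁ Q.actLeft) ▷ W ≫ f)
    (g : Z ⟶ Z') : proj P Q ▷ W ≫ descR f h ≫ g = f ≫ g := by
  rw [← Category.assoc, proj_descR]

/-- The left action of `R` on `P ⊗_R Q`. -/
def actLeft (P Q : Bimod R R) : R.X ⊗ obj P Q ⟶ obj P Q :=
  descL ((α_ R.X P.X Q.X).inv ≫ P.actLeft ▷ Q.X ≫ proj P Q) (by
    slice_lhs 1 2 => rw [associator_inv_naturality_middle]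
    slice_rhs 2 3 => rw [associator_inv_naturality_right]
    slice_rhs 3 4 => rw [whisker_exchange]
    slice_rhs 4 5 => rw [← Iso.inv_hom_id_assoc (α_ P.X R.X Q.X) (P.X ◁ Q.actLeft)]
    slice_rhs 5 7 => rw [← proj_condition]
    slice_lhs 2 3 => rw [← comp_whiskerRight, ← Iso.inv_hom_id_assoc (α_ R.X P.X R.X)
      (R.X ◁ P.actRight), Category.assoc, Category.assoc, ← Bimod.middle_assoc,
      comp_whiskerRight, comp_whiskerRight]
    simp)

@[simp] lemma whiskerLeft_proj_actLeft (P Q : Bimod R R) :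
    R.X ◁ proj P Q ≫ actLeft P Q = (α_ R.X P.X Q.X).inv ≫ P.actLeft ▷ Q.X ≫ proj P Q :=
  proj_descL _ _

@[simp] lemma whiskerLeft_proj_actLeft_assoc (P Q : Bimod R R) {Z : M} (h : obj P Q ⟶ Z) :
    R.X ◁ proj P Q ≫ actLeft P Q ≫ h =
      (α_ R.X P.X Q.X).inv ≫ P.actLeft ▷ Q.X ≫ proj P Q ≫ h := by
  rw [← Category.assoc, whiskerLeft_proj_actLeft]
  simp only [Category.assoc]

/-- The right action of `R` on `P ⊗_R Q`. -/
def actRight (P Q : Bimod R R) : obj P Q ⊗ R.X ⟶ obj P Q :=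
  descR ((α_ P.X Q.X R.X).hom ≫ P.X ◁ Q.actRight ≫ proj P Q) (by
    slice_lhs 1 2 => rw [associator_naturality_left]
    slice_lhs 2 3 => rw [← whisker_exchange]
    slice_lhs 3 4 => rw [proj_condition]
    slice_rhs 2 3 => rw [associator_naturality_middle]
    slice_rhs 3 4 => rw [← whiskerLeft_comp, Bimod.middle_assoc]
    simp)

@[simp] lemma proj_whiskerRight_actRight (P Q : Bimod R R) :
    proj P Q ▷ R.X ≫ actRight P Q = (α_ P.X Q.X R.X).hom ≫ P.X ◁ Q.actRight ≫ proj P Q :=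
  proj_descR _ _

@[simp] lemma proj_whiskerRight_actRight_assoc (P Q : Bimod R R) {Z : M} (h : obj P Q ⟶ Z) :
    proj P Q ▷ R.X ≫ actRight P Q ≫ h =
      (α_ P.X Q.X R.X).hom ≫ P.X ◁ Q.actRight ≫ proj P Q ≫ h := by
  rw [← Category.assoc, proj_whiskerRight_actRight]
  simp only [Category.assoc]

/-- The tensor product `P ⊗_R Q` of two `R`-`R`-bimodules. -/
abbrev tensor (P Q : Bimod R R) : Bimod R R where
  X := obj P Q
  actLeft := actLeft P Q
  actRight := actRight P Q
  one_actLeft := by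
    rw [← cancel_epi (𝟙_ M ◁ proj P Q)]
    slice_lhs 1 2 => rw [whisker_exchange]
    slice_lhs 2 3 => rw [whiskerLeft_proj_actLeft]
    slice_lhs 1 2 => rw [associator_inv_naturality_left]
    slice_lhs 2 3 => rw [← comp_whiskerRight, Bimod.one_actLeft]
    simp
  left_assoc := by
    rw [← cancel_epi ((R.X ⊗ R.X) ◁ proj P Q)]
    slice_lhs 1 2 => rw [whisker_exchange]
    slice_lhs 2 3 => rw [whiskerLeft_proj_actLeft]
    slice_lhs 1 2 => rw [associator_inv_naturality_left]
    slice_lhs 2 3 => rw [← comp_whiskerRight, Bimod.left_assoc, comp_whiskerRight,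
      comp_whiskerRight]
    slice_rhs 1 2 => rw [associator_naturality_right]
    slice_rhs 2 3 => rw [← whiskerLeft_comp, whiskerLeft_proj_actLeft, whiskerLeft_comp,
      whiskerLeft_comp]
    slice_rhs 4 5 => rw [whiskerLeft_proj_actLeft]
    slice_rhs 3 4 => rw [associator_inv_naturality_middle]
    simp
  actRight_one := by
    rw [← cancel_epi (proj P Q ▷ 𝟙_ M)]
    slice_lhs 1 2 => rw [← whisker_exchange]
    slice_lhs 2 3 => rw [proj_whiskerRight_actRight]
    slice_lhs 1 2 => rw [associator_naturality_right]
    slice_lhs 2 3 => rw [← whiskerLeft_comp, Bimod.actRight_one]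
    simp
  right_assoc := by
    rw [← cancel_epi (proj P Q ▷ (R.X ⊗ R.X))]
    slice_lhs 1 2 => rw [← whisker_exchange]
    slice_lhs 2 3 => rw [proj_whiskerRight_actRight]
    slice_lhs 1 2 => rw [associator_naturality_right]
    slice_lhs 2 3 => rw [← whiskerLeft_comp, Bimod.right_assoc, whiskerLeft_comp,
      whiskerLeft_comp]
    slice_rhs 1 2 => rw [associator_inv_naturality_left]
    slice_rhs 2 3 => rw [← comp_whiskerRight, proj_whiskerRight_actRight, comp_whiskerRight,
      comp_whiskerRight]
    slice_rhs 4 5 => rw [proj_whiskerRight_actRight]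
    simp
  middle_assoc := by
    rw [← cancel_epi ((R.X ◁ proj P Q) ▷ R.X)]
    slice_lhs 1 2 => rw [← comp_whiskerRight, whiskerLeft_proj_actLeft, comp_whiskerRight,
      comp_whiskerRight]
    slice_lhs 3 4 => rw [proj_whiskerRight_actRight]
    slice_lhs 2 3 => rw [associator_naturality_left]
    slice_rhs 1 2 => rw [associator_naturality_middle]
    slice_rhs 2 3 => rw [← whiskerLeft_comp, proj_whiskerRight_actRight, whiskerLeft_comp,
      whiskerLeft_comp]
    slice_rhs 4 5 => rw [whiskerLeft_proj_actLeft]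
    slice_rhs 3 4 => rw [associator_inv_naturality_right]
    slice_rhs 4 5 => rw [whisker_exchange]
    simp

/-- Two arrows out of `P ⊗_R Q` agree if they agree on `P ⊗ Q`. -/
lemma hom_ext {P Q : Bimod R R} {Z : M} {f g : obj P Q ⟶ Z}
    (h : proj P Q ≫ f = proj P Q ≫ g) : f = g :=
  (cancel_epi _).1 h

/-- The arrow `f ⊗_R g` underlying the tensor product of two bimodule morphisms. -/
def map {P P' Q Q' : Bimod R R} (f : P ⟶ P') (g : Q ⟶ Q') : obj P Q ⟶ obj P' Q' :=
  desc ((f.hom ⊗ₘ g.hom) ≫ proj P' Q') (by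
    rw [MonoidalCategory.tensorHom_def]
    slice_lhs 1 2 => rw [← comp_whiskerRight, Bimod.Hom.right_act_hom, comp_whiskerRight]
    slice_lhs 2 3 => rw [← whisker_exchange]
    slice_lhs 3 4 => rw [proj_condition]
    slice_rhs 2 3 => rw [whisker_exchange]
    slice_rhs 3 4 => rw [← whiskerLeft_comp, Bimod.Hom.left_act_hom, whiskerLeft_comp]
    simp)

@[simp] lemma proj_map {P P' Q Q' : Bimod R R} (f : P ⟶ P') (g : Q ⟶ Q') :
    proj P Q ≫ map f g = (f.hom ⊗ₘ g.hom) ≫ proj P' Q' :=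
  proj_desc _ _

@[simp] lemma proj_map_assoc {P P' Q Q' : Bimod R R} (f : P ⟶ P') (g : Q ⟶ Q') {Z : M}
    (h : obj P' Q' ⟶ Z) :
    proj P Q ≫ map f g ≫ h = (f.hom ⊗ₘ g.hom) ≫ proj P' Q' ≫ h := by
  rw [← Category.assoc, proj_map, Category.assoc]

/-- The tensor product `f ⊗_R g` of two bimodule morphisms. -/
abbrev tensorHom {P P' Q Q' : Bimod R R} (f : P ⟶ P') (g : Q ⟶ Q') :
    tensor P Q ⟶ tensor P' Q' where
  hom := map f g
  left_act_hom := by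
    rw [← cancel_epi (R.X ◁ proj P Q)]
    slice_rhs 1 2 => rw [← whiskerLeft_comp, proj_map, whiskerLeft_comp]
    simp only [Category.assoc, whiskerLeft_proj_actLeft, whiskerLeft_proj_actLeft_assoc, proj_map]
    simp only [MonoidalCategory.tensorHom_def, whiskerLeft_comp, Category.assoc]
    slice_lhs 2 3 => rw [← comp_whiskerRight, Bimod.Hom.left_act_hom, comp_whiskerRight]
    slice_rhs 2 3 => rw [associator_inv_naturality_right]
    slice_rhs 3 4 => rw [whisker_exchange]
    simp
  right_act_hom := by
    rw [← cancel_epi (proj P Q ▷ R.X)]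
    slice_rhs 1 2 => rw [← comp_whiskerRight, proj_map, comp_whiskerRight]
    simp only [Category.assoc, proj_whiskerRight_actRight, proj_whiskerRight_actRight_assoc,
      proj_map]
    simp only [MonoidalCategory.tensorHom_def', comp_whiskerRight, Category.assoc]
    slice_lhs 2 3 => rw [← whiskerLeft_comp, Bimod.Hom.right_act_hom, whiskerLeft_comp]
    slice_rhs 2 3 => rw [associator_naturality_left]
    slice_rhs 3 4 => rw [← whisker_exchange]
    simp

/-- The arrow underlying the associator, before passing to the outer tensor product. -/
def assocAux (P Q L : Bimod R R) : obj P Q ⊗ L.X ⟶ obj P (tensor Q L) :=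
  descR ((α_ P.X Q.X L.X).hom ≫ P.X ◁ proj Q L ≫ proj P (tensor Q L)) (by
    slice_lhs 1 2 => rw [associator_naturality_left]
    slice_lhs 2 3 => rw [← whisker_exchange]
    slice_lhs 3 4 => rw [proj_condition P (tensor Q L)]
    slice_lhs 2 3 => rw [associator_naturality_right]
    slice_lhs 3 4 => rw [← whiskerLeft_comp, whiskerLeft_proj_actLeft, whiskerLeft_comp]
    simp)

@[simp] lemma proj_assocAux (P Q L : Bimod R R) :
    proj P Q ▷ L.X ≫ assocAux P Q L =
      (α_ P.X Q.X L.X).hom ≫ P.X ◁ proj Q L ≫ proj P (tensor Q L) :=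
  proj_descR _ _

/-- The arrow underlying the associator. -/
def assocHom (P Q L : Bimod R R) : obj (tensor P Q) L ⟶ obj P (tensor Q L) :=
  desc (assocAux P Q L) (by
    rw [← cancel_epi (proj P Q ▷ R.X ▷ L.X)]
    slice_lhs 1 2 => rw [← comp_whiskerRight, proj_whiskerRight_actRight, comp_whiskerRight,
      comp_whiskerRight]
    slice_lhs 3 4 => rw [proj_assocAux]
    slice_lhs 2 3 => rw [associator_naturality_middle]
    slice_lhs 3 4 => rw [← whiskerLeft_comp, proj_condition, whiskerLeft_comp, whiskerLeft_comp]
    slice_rhs 1 2 => rw [associator_naturality_left]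
    slice_rhs 2 3 => rw [← whisker_exchange]
    slice_rhs 3 4 => rw [proj_assocAux]
    simp)

@[simp] lemma proj_proj_assocHom (P Q L : Bimod R R) :
    proj P Q ▷ L.X ≫ proj (tensor P Q) L ≫ assocHom P Q L =
      (α_ P.X Q.X L.X).hom ≫ P.X ◁ proj Q L ≫ proj P (tensor Q L) := by
  rw [assocHom, proj_desc, proj_assocAux]

@[simp] lemma proj_proj_assocHom_assoc (P Q L : Bimod R R) {Z : M}
    (h : obj P (tensor Q L) ⟶ Z) :
    proj P Q ▷ L.X ≫ proj (tensor P Q) L ≫ assocHom P Q L ≫ h =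
      (α_ P.X Q.X L.X).hom ≫ P.X ◁ proj Q L ≫ proj P (tensor Q L) ≫ h := by
  have := proj_proj_assocHom P Q L =≫ h
  simpa only [Category.assoc] using this

/-- The arrow underlying the inverse associator, before passing to the outer tensor product. -/
def assocInvAux (P Q L : Bimod R R) : P.X ⊗ obj Q L ⟶ obj (tensor P Q) L :=
  descL ((α_ P.X Q.X L.X).inv ≫ proj P Q ▷ L.X ≫ proj (tensor P Q) L) (by
    slice_lhs 1 2 => rw [associator_inv_naturality_middle]
    slice_rhs 2 3 => rw [associator_inv_naturality_right]
    slice_rhs 3 4 => rw [whisker_exchange]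
    slice_rhs 4 5 => rw [← Iso.inv_hom_id_assoc (α_ (obj P Q) R.X L.X) (obj P Q ◁ L.actLeft)]
    slice_rhs 5 7 => rw [← proj_condition (tensor P Q) L]
    slice_rhs 3 4 => rw [associator_inv_naturality_left]
    slice_rhs 4 5 => rw [← comp_whiskerRight, proj_whiskerRight_actRight]
    simp)

@[simp] lemma proj_assocInvAux (P Q L : Bimod R R) :
    P.X ◁ proj Q L ≫ assocInvAux P Q L =
      (α_ P.X Q.X L.X).inv ≫ proj P Q ▷ L.X ≫ proj (tensor P Q) L :=
  proj_descL _ _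

/-- The arrow underlying the inverse associator. -/
def assocInv (P Q L : Bimod R R) : obj P (tensor Q L) ⟶ obj (tensor P Q) L :=
  desc (assocInvAux P Q L) (by
    rw [← cancel_epi ((P.X ⊗ R.X) ◁ proj Q L)]
    slice_lhs 1 2 => rw [whisker_exchange]
    slice_lhs 2 3 => rw [proj_assocInvAux]
    slice_lhs 1 2 => rw [associator_inv_naturality_left]
    slice_lhs 2 3 => rw [← comp_whiskerRight, proj_condition, comp_whiskerRight,
      comp_whiskerRight]
    slice_rhs 1 2 => rw [associator_naturality_right]
    slice_rhs 2 3 => rw [← whiskerLeft_comp, whiskerLeft_proj_actLeft, whiskerLeft_comp,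
      whiskerLeft_comp]
    slice_rhs 4 5 => rw [proj_assocInvAux]
    simp)

@[simp] lemma proj_proj_assocInv (P Q L : Bimod R R) :
    P.X ◁ proj Q L ≫ proj P (tensor Q L) ≫ assocInv P Q L =
      (α_ P.X Q.X L.X).inv ≫ proj P Q ▷ L.X ≫ proj (tensor P Q) L := by
  rw [assocInv, proj_desc, proj_assocInvAux]

/-- Two arrows out of `(P ⊗_R Q) ⊗_R L` agree if they agree on `(P ⊗ Q) ⊗ L`. -/
lemma hom_ext₃ {P Q L : Bimod R R} {Z : M} {f g : obj (tensor P Q) L ⟶ Z}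
    (h : proj P Q ▷ L.X ≫ proj (tensor P Q) L ≫ f =
      proj P Q ▷ L.X ≫ proj (tensor P Q) L ≫ g) : f = g := by
  rwa [cancel_epi, cancel_epi] at h

/-- Two arrows out of `P ⊗_R (Q ⊗_R L)` agree if they agree on `P ⊗ (Q ⊗ L)`. -/
lemma hom_ext₃' {P Q L : Bimod R R} {Z : M} {f g : obj P (tensor Q L) ⟶ Z}
    (h : P.X ◁ proj Q L ≫ proj P (tensor Q L) ≫ f =
      P.X ◁ proj Q L ≫ proj P (tensor Q L) ≫ g) : f = g := by
  rwa [cancel_epi, cancel_epi] at h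

/-- The associator `(P ⊗_R Q) ⊗_R L ≅ P ⊗_R (Q ⊗_R L)`. -/
abbrev associator (P Q L : Bimod R R) :
    tensor (tensor P Q) L ≅ tensor P (tensor Q L) :=
  Bimod.isoOfIso (P := tensor (tensor P Q) L) (Q := tensor P (tensor Q L))
    { hom := assocHom P Q L
      inv := assocInv P Q L
      hom_inv_id := by
        apply hom_ext₃
        rw [proj_proj_assocHom_assoc, proj_proj_assocInv, Iso.hom_inv_id_assoc, Category.comp_id]
      inv_hom_id := by
        apply hom_ext₃'
        rw [← Category.assoc, ← Category.assoc, Category.assoc _ _ (assocInv P Q L),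
          proj_proj_assocInv, Category.assoc, Category.assoc, proj_proj_assocHom,
          Iso.inv_hom_id_assoc, Category.comp_id] }
    (by
      rw [← cancel_epi (R.X ◁ proj (tensor P Q) L), ← cancel_epi (R.X ◁ proj P Q ▷ L.X)]
      simp only [whiskerLeft_proj_actLeft_assoc]
      slice_lhs 1 2 => rw [associator_inv_naturality_middle]
      slice_lhs 2 3 => rw [← comp_whiskerRight, whiskerLeft_proj_actLeft, comp_whiskerRight,
        comp_whiskerRight]
      slice_lhs 4 6 => rw [proj_proj_assocHom]
      slice_rhs 1 3 => rw [← whiskerLeft_comp, ← whiskerLeft_comp,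
        proj_proj_assocHom, whiskerLeft_comp, whiskerLeft_comp]
      slice_rhs 3 4 => rw [whiskerLeft_proj_actLeft]
      slice_rhs 2 3 => rw [associator_inv_naturality_right]
      slice_rhs 3 4 => rw [whisker_exchange]
      simp)
    (by
      rw [← cancel_epi (proj (tensor P Q) L ▷ R.X), ← cancel_epi (proj P Q ▷ L.X ▷ R.X)]
      simp only [proj_whiskerRight_actRight_assoc]
      slice_lhs 1 2 => rw [associator_naturality_left]
      slice_lhs 2 3 => rw [← whisker_exchange]
      slice_lhs 3 5 => rw [proj_proj_assocHom]
      slice_rhs 1 3 => rw [← comp_whiskerRight, ← comp_whiskerRight,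
        proj_proj_assocHom, comp_whiskerRight, comp_whiskerRight]
      slice_rhs 3 4 => rw [proj_whiskerRight_actRight]
      slice_rhs 2 3 => rw [associator_naturality_middle]
      slice_rhs 3 4 => rw [← whiskerLeft_comp, proj_whiskerRight_actRight, whiskerLeft_comp,
        whiskerLeft_comp]
      simp)

/-- The monoid `R` as a bimodule over itself. -/
abbrev unit (R : Mon M) : Bimod R R where
  X := R.X
  actLeft := μ
  actRight := μ

/-- The arrow `R ⊗_R P ⟶ P` induced by the left action. -/
def leftUnitorHom (P : Bimod R R) : obj (unit R) P ⟶ P.X :=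
  desc P.actLeft (Bimod.left_assoc P)

@[simp] lemma proj_leftUnitorHom (P : Bimod R R) :
    proj (unit R) P ≫ leftUnitorHom P = P.actLeft :=
  proj_desc _ _

@[simp] lemma proj_leftUnitorHom_assoc (P : Bimod R R) {Z : M} (h : P.X ⟶ Z) :
    proj (unit R) P ≫ leftUnitorHom P ≫ h = P.actLeft ≫ h :=
  proj_desc_assoc _ _ _

/-- The inverse `P ⟶ R ⊗_R P` of the left unit arrow, induced by the unit of `R`. -/
def leftUnitorInv (P : Bimod R R) : P.X ⟶ obj (unit R) P :=
  (λ_ P.X).inv ≫ η[R.X] ▷ P.X ≫ proj (unit R) P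

/-- The left unit isomorphism `R ⊗_R P ≅ P`, induced by the left action. -/
abbrev leftUnitor (P : Bimod R R) : tensor (unit R) P ≅ P :=
  Bimod.isoOfIso (P := tensor (unit R) P) (Q := P)
    { hom := leftUnitorHom P
      inv := leftUnitorInv P
      hom_inv_id := by
        apply hom_ext
        have h := proj_condition (unit R) P
        rw [proj_leftUnitorHom_assoc, leftUnitorInv]
        slice_lhs 1 2 => rw [leftUnitor_inv_naturality]
        slice_lhs 2 3 => rw [whisker_exchange]
        slice_lhs 3 4 => rw [← Iso.inv_hom_id_assoc (α_ R.X R.X P.X) (R.X ◁ P.actLeft)]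
        slice_lhs 4 6 => rw [← h]
        slice_lhs 2 3 => rw [associator_inv_naturality_left]
        slice_lhs 3 4 => rw [← comp_whiskerRight, MonObj.one_mul]
        simp
      inv_hom_id := by
        simp only [leftUnitorInv, Category.assoc, proj_leftUnitorHom, Bimod.one_actLeft,
          Iso.inv_hom_id] }
    (by
      change actLeft (unit R) P ≫ leftUnitorHom P = R.X ◁ leftUnitorHom P ≫ P.actLeft
      rw [← cancel_epi (R.X ◁ proj (unit R) P), whiskerLeft_proj_actLeft_assoc,
        ← whiskerLeft_comp_assoc, proj_leftUnitorHom, Bimod.left_assoc, Iso.inv_hom_id_assoc])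
    (by
      change actRight (unit R) P ≫ leftUnitorHom P = leftUnitorHom P ▷ R.X ≫ P.actRight
      rw [← cancel_epi (proj (unit R) P ▷ R.X), proj_whiskerRight_actRight_assoc,
        ← comp_whiskerRight_assoc, proj_leftUnitorHom, Bimod.middle_assoc])

/-- The arrow `P ⊗_R R ⟶ P` induced by the right action. -/
def rightUnitorHom (P : Bimod R R) : obj P (unit R) ⟶ P.X :=
  desc P.actRight (by rw [Bimod.right_assoc, Iso.hom_inv_id_assoc])

@[simp] lemma proj_rightUnitorHom (P : Bimod R R) :
    proj P (unit R) ≫ rightUnitorHom P = P.actRight :=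
  proj_desc _ _

@[simp] lemma proj_rightUnitorHom_assoc (P : Bimod R R) {Z : M} (h : P.X ⟶ Z) :
    proj P (unit R) ≫ rightUnitorHom P ≫ h = P.actRight ≫ h :=
  proj_desc_assoc _ _ _

/-- The inverse `P ⟶ P ⊗_R R` of the right unit arrow, induced by the unit of `R`. -/
def rightUnitorInv (P : Bimod R R) : P.X ⟶ obj P (unit R) :=
  (ρ_ P.X).inv ≫ P.X ◁ η[R.X] ≫ proj P (unit R)

/-- The right unit isomorphism `P ⊗_R R ≅ P`, induced by the right action. -/
abbrev rightUnitor (P : Bimod R R) : tensor P (unit R) ≅ P :=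
  Bimod.isoOfIso (P := tensor P (unit R)) (Q := P)
    { hom := rightUnitorHom P
      inv := rightUnitorInv P
      hom_inv_id := by
        apply hom_ext
        have h := proj_condition P (unit R)
        rw [proj_rightUnitorHom_assoc, rightUnitorInv]
        slice_lhs 1 2 => rw [rightUnitor_inv_naturality]
        slice_lhs 2 3 => rw [← whisker_exchange]
        slice_lhs 3 4 => rw [h]
        slice_lhs 2 3 => rw [associator_naturality_right]
        slice_lhs 3 4 => rw [← whiskerLeft_comp, MonObj.mul_one]
        simp
      inv_hom_id := by
        simp only [rightUnitorInv, Category.assoc, proj_rightUnitorHom, Bimod.actRight_one,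
          Iso.inv_hom_id] }
    (by
      change actLeft P (unit R) ≫ rightUnitorHom P = R.X ◁ rightUnitorHom P ≫ P.actLeft
      rw [← cancel_epi (R.X ◁ proj P (unit R)), whiskerLeft_proj_actLeft_assoc,
        ← whiskerLeft_comp_assoc, proj_rightUnitorHom, Bimod.middle_assoc,
        Iso.inv_hom_id_assoc])
    (by
      change actRight P (unit R) ≫ rightUnitorHom P = rightUnitorHom P ▷ R.X ≫ P.actRight
      rw [← cancel_epi (proj P (unit R) ▷ R.X), proj_whiskerRight_actRight_assoc,
        ← comp_whiskerRight_assoc, proj_rightUnitorHom, Bimod.right_assoc,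
        Iso.hom_inv_id_assoc])

end BimodTensor

open BimodTensor

namespace BimodTensor

open MonObj

variable {M : Type u₂} [Category.{v} M] [MonoidalCategory M] [HasCoequalizers M] {R : Mon M}
variable [∀ X : M, PreservesColimitsOfShape WalkingParallelPair (tensorLeft X)]
variable [∀ X : M, PreservesColimitsOfShape WalkingParallelPair (tensorRight X)]

instance : MonoidalCategoryStruct (Bimod R R) where
  tensorObj P Q := tensor P Q
  whiskerLeft P _ _ g := tensorHom (𝟙 P) g
  whiskerRight f Q := tensorHom f (𝟙 Q)
  tensorHom f g := tensorHom f g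
  tensorUnit := unit R
  associator P Q L := associator P Q L
  leftUnitor P := leftUnitor P
  rightUnitor P := rightUnitor P

/-- The category `_R M_R` of bimodules is monoidal, with the tensor product over `R`. -/
instance monoidalBimod : MonoidalCategory (Bimod R R) where
  tensorHom_def f g := by
    apply Bimod.hom_ext
    apply hom_ext
    change proj _ _ ≫ map f g = proj _ _ ≫ map f (𝟙 _) ≫ map (𝟙 _) g
    rw [proj_map, proj_map_assoc, proj_map, ← Category.assoc, tensorHom_comp_tensorHom]
    simp
  id_tensorHom_id P Q := by
    apply Bimod.hom_ext
    apply hom_ext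
    change proj _ _ ≫ map (𝟙 P) (𝟙 Q) = proj _ _ ≫ 𝟙 (obj P Q)
    rw [proj_map]
    simp
  tensorHom_comp_tensorHom f₁ f₂ g₁ g₂ := by
    apply Bimod.hom_ext
    apply hom_ext
    change proj _ _ ≫ map f₁ f₂ ≫ map g₁ g₂ = proj _ _ ≫ map (f₁ ≫ g₁) (f₂ ≫ g₂)
    rw [proj_map_assoc, proj_map, proj_map, ← Category.assoc, tensorHom_comp_tensorHom]
    rfl
  whiskerLeft_id P Q := by
    apply Bimod.hom_ext
    apply hom_ext
    change proj _ _ ≫ map (𝟙 P) (𝟙 Q) = proj _ _ ≫ 𝟙 (obj P Q)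
    rw [proj_map]
    simp
  id_whiskerRight P Q := by
    apply Bimod.hom_ext
    apply hom_ext
    change proj _ _ ≫ map (𝟙 P) (𝟙 Q) = proj _ _ ≫ 𝟙 (obj P Q)
    rw [proj_map]
    simp
  associator_naturality {X₁ X₂ X₃ Y₁ Y₂ Y₃} f₁ f₂ f₃ := by
    apply Bimod.hom_ext
    apply hom_ext₃
    change proj X₁ X₂ ▷ X₃.X ≫ proj (tensor X₁ X₂) X₃ ≫
        map (tensorHom f₁ f₂) f₃ ≫ assocHom Y₁ Y₂ Y₃ =
      proj X₁ X₂ ▷ X₃.X ≫ proj (tensor X₁ X₂) X₃ ≫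
        assocHom X₁ X₂ X₃ ≫ map f₁ (tensorHom f₂ f₃)
    rw [proj_map_assoc, proj_proj_assocHom_assoc, proj_map, MonoidalCategory.tensorHom_def]
    change _ ≫ (map f₁ f₂ ▷ X₃.X ≫ obj Y₁ Y₂ ◁ f₃.hom) ≫ _ = _ ≫ _ ≫ (f₁.hom ⊗ₘ map f₂ f₃) ≫ _
    slice_lhs 1 2 => rw [← comp_whiskerRight, proj_map, comp_whiskerRight]
    slice_lhs 2 3 => rw [← whisker_exchange]
    slice_lhs 3 5 => rw [proj_proj_assocHom]
    rw [MonoidalCategory.tensorHom_def' f₁.hom (map f₂ f₃)]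
    slice_rhs 2 3 => rw [← whiskerLeft_comp, proj_map, whiskerLeft_comp]
    slice_rhs 3 4 => rw [whisker_exchange]
    have h := MonoidalCategory.associator_naturality f₁.hom f₂.hom f₃.hom
    rw [MonoidalCategory.tensorHom_def (f₁.hom ⊗ₘ f₂.hom) f₃.hom,
      MonoidalCategory.tensorHom_def' f₁.hom (f₂.hom ⊗ₘ f₃.hom)] at h
    simpa only [Category.assoc] using h =≫ (Y₁.X ◁ proj Y₂ Y₃ ≫ proj Y₁ (tensor Y₂ Y₃))
  leftUnitor_naturality {P Q} f := by
    apply Bimod.hom_ext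
    apply hom_ext
    change proj _ _ ≫ map (𝟙 (unit R)) f ≫ leftUnitorHom Q = proj _ _ ≫ leftUnitorHom P ≫ f.hom
    rw [proj_map_assoc, proj_leftUnitorHom, proj_leftUnitorHom_assoc, f.left_act_hom]
    simp
  rightUnitor_naturality {P Q} f := by
    apply Bimod.hom_ext
    apply hom_ext
    change proj _ _ ≫ map f (𝟙 (unit R)) ≫ rightUnitorHom Q =
      proj _ _ ≫ rightUnitorHom P ≫ f.hom
    rw [proj_map_assoc, proj_rightUnitorHom, proj_rightUnitorHom_assoc, f.right_act_hom]
    simp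
  pentagon P Q L N := by
    apply Bimod.hom_ext
    apply hom_ext₃
    rw [← cancel_epi (proj P Q ▷ L.X ▷ N.X)]
    change _ ≫ proj (tensor P Q) L ▷ N.X ≫ proj (tensor (tensor P Q) L) N ≫
        map (associator P Q L).hom (𝟙 N) ≫ assocHom P (tensor Q L) N ≫
          map (𝟙 P) (associator Q L N).hom =
      _ ≫ proj (tensor P Q) L ▷ N.X ≫ proj (tensor (tensor P Q) L) N ≫
        assocHom (tensor P Q) L N ≫ assocHom P Q (tensor L N)
    rw [proj_map_assoc, proj_proj_assocHom_assoc (tensor P Q) L N]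
    change _ ≫ _ ≫ (assocHom P Q L ⊗ₘ 𝟙 N.X) ≫ _ = _
    rw [tensorHom_id]
    slice_lhs 1 3 => rw [← comp_whiskerRight, ← comp_whiskerRight, proj_proj_assocHom,
      comp_whiskerRight, comp_whiskerRight]
    slice_lhs 3 5 => rw [proj_proj_assocHom P (tensor Q L) N]
    slice_lhs 5 6 => rw [proj_map]
    change (_ ≫ _ ≫ _ ≫ _ ≫ (𝟙 P.X ⊗ₘ assocHom Q L N) ≫ _) = _
    rw [id_tensorHom]
    slice_lhs 2 3 => rw [associator_naturality_middle]
    slice_lhs 3 5 => rw [← whiskerLeft_comp, ← whiskerLeft_comp, proj_proj_assocHom,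
      whiskerLeft_comp, whiskerLeft_comp]
    slice_rhs 1 2 => rw [associator_naturality_left]
    slice_rhs 2 3 => rw [← whisker_exchange]
    slice_rhs 3 5 => rw [proj_proj_assocHom P Q (tensor L N)]
    simp
  triangle P Q := by
    apply Bimod.hom_ext
    apply hom_ext₃
    change proj P (unit R) ▷ Q.X ≫ proj (tensor P (unit R)) Q ≫
        assocHom P (unit R) Q ≫ map (𝟙 P) (leftUnitor Q).hom =
      proj P (unit R) ▷ Q.X ≫ proj (tensor P (unit R)) Q ≫ map (rightUnitor P).hom (𝟙 Q)
    rw [proj_proj_assocHom_assoc, proj_map, proj_map]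
    change _ ≫ _ ≫ (𝟙 P.X ⊗ₘ leftUnitorHom Q) ≫ _ = _ ≫ (rightUnitorHom P ⊗ₘ 𝟙 Q.X) ≫ _
    rw [id_tensorHom, tensorHom_id, ← whiskerLeft_comp_assoc, ← comp_whiskerRight_assoc,
      proj_leftUnitorHom, proj_rightUnitorHom, proj_condition]

end BimodTensor

section ForgetBimod

variable {M : Type u₂} [Category.{v} M] [MonoidalCategory M] [HasCoequalizers M]
variable [∀ X : M, PreservesColimitsOfShape WalkingParallelPair (tensorLeft X)]
variable [∀ X : M, PreservesColimitsOfShape WalkingParallelPair (tensorRight X)]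

/-- The forgetful functor `Γ : _R M_R ⥤ M`. -/
abbrev forgetBimod (R : Mon M) : Bimod R R ⥤ M := Bimod.forget R

/-- The monoidal structure of `Γ`: the chosen coequalizers `x ⊗ y ⟶ x ⊗_R y` and the unit of the
monoid `R`. -/
instance forgetBimodLaxMonoidal (R : Mon M) : (forgetBimod R).LaxMonoidal where
  ε := (MonObj.one : 𝟙_ M ⟶ R.X)
  μ P Q := proj P Q
  μ_natural_left {P P'} f Q := by
    change f.hom ▷ Q.X ≫ proj P' Q = proj P Q ≫ map f (𝟙 Q)
    rw [proj_map, Bimod.id_hom', tensorHom_id]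
  μ_natural_right {Q Q'} P f := by
    change P.X ◁ f.hom ≫ proj P Q' = proj P Q ≫ map (𝟙 P) f
    rw [proj_map, Bimod.id_hom', id_tensorHom]
  associativity P Q L := proj_proj_assocHom P Q L
  left_unitality P := by
    change (λ_ P.X).hom = (MonObj.one : 𝟙_ M ⟶ R.X) ▷ P.X ≫ proj (unit R) P ≫ leftUnitorHom P
    rw [proj_leftUnitorHom, Bimod.one_actLeft]
  right_unitality P := by
    change (ρ_ P.X).hom = P.X ◁ (MonObj.one : 𝟙_ M ⟶ R.X) ≫ proj P (unit R) ≫ rightUnitorHom P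
    rw [proj_rightUnitorHom, Bimod.actRight_one]

end ForgetBimod

section CanonicalFactorization

open Functor.LaxMonoidal

variable {C : Type u₁} [Category.{v} C] [MonoidalCategory C]
variable {M : Type u₂} [Category.{v} M] [MonoidalCategory M]

/-- The monoid `R = G e` in `M`, the image under `G` of the unit monoid of `C`. Its multiplication
is `G (λ_ e) ∘ G_{e,e}` and its unit is `G_0`. -/
abbrev baseMonoid (G : C ⥤ M) [G.LaxMonoidal] : Mon M where
  X := G.obj (𝟙_ C)
  mon :=
    { one := ε G
      mul := μ G (𝟙_ C) (𝟙_ C) ≫ G.map (λ_ (𝟙_ C)).hom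
      one_mul := (left_unitality G (𝟙_ C)).symm
      mul_one := by rw [unitors_equal, ← right_unitality]
      mul_assoc := by
        rw [comp_whiskerRight, Category.assoc, μ_natural_left_assoc, whiskerLeft_comp,
          Category.assoc, μ_natural_right_assoc, ← associativity_assoc, ← G.map_comp,
          ← G.map_comp, ← G.map_comp]
        congr 3
        monoidal }

/-- The object `G c` with its canonical left and right actions of `R = G e`. -/
abbrev canonicalObj (G : C ⥤ M) [G.LaxMonoidal] (c : C) :
    Bimod (baseMonoid G) (baseMonoid G) where
  X := G.obj c
  actLeft := μ G (𝟙_ C) c ≫ G.map (λ_ c).hom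
  actRight := μ G c (𝟙_ C) ≫ G.map (ρ_ c).hom
  one_actLeft := (left_unitality G c).symm
  left_assoc := by
    change (μ G (𝟙_ C) (𝟙_ C) ≫ G.map (λ_ (𝟙_ C)).hom) ▷ G.obj c ≫ μ G (𝟙_ C) c ≫ G.map (λ_ c).hom =
      (α_ (G.obj (𝟙_ C)) (G.obj (𝟙_ C)) (G.obj c)).hom ≫
        G.obj (𝟙_ C) ◁ (μ G (𝟙_ C) c ≫ G.map (λ_ c).hom) ≫ μ G (𝟙_ C) c ≫ G.map (λ_ c).hom
    rw [comp_whiskerRight, Category.assoc, μ_natural_left_assoc, whiskerLeft_comp,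
      Category.assoc, μ_natural_right_assoc, ← associativity_assoc, ← G.map_comp, ← G.map_comp,
      ← G.map_comp]
    congr 3
    monoidal
  actRight_one := (right_unitality G c).symm
  right_assoc := by
    change G.obj c ◁ (μ G (𝟙_ C) (𝟙_ C) ≫ G.map (λ_ (𝟙_ C)).hom) ≫ μ G c (𝟙_ C) ≫ G.map (ρ_ c).hom =
      (α_ (G.obj c) (G.obj (𝟙_ C)) (G.obj (𝟙_ C))).inv ≫
        (μ G c (𝟙_ C) ≫ G.map (ρ_ c).hom) ▷ G.obj (𝟙_ C) ≫ μ G c (𝟙_ C) ≫ G.map (ρ_ c).hom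
    rw [← cancel_epi (α_ (G.obj c) (G.obj (𝟙_ C)) (G.obj (𝟙_ C))).hom, Iso.hom_inv_id_assoc,
      comp_whiskerRight, Category.assoc, μ_natural_left_assoc, whiskerLeft_comp,
      Category.assoc, μ_natural_right_assoc, ← associativity_assoc, ← G.map_comp, ← G.map_comp,
      ← G.map_comp]
    congr 3
    monoidal
  middle_assoc := by
    change (μ G (𝟙_ C) c ≫ G.map (λ_ c).hom) ▷ G.obj (𝟙_ C) ≫ μ G c (𝟙_ C) ≫ G.map (ρ_ c).hom =
      (α_ (G.obj (𝟙_ C)) (G.obj c) (G.obj (𝟙_ C))).hom ≫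
        G.obj (𝟙_ C) ◁ (μ G c (𝟙_ C) ≫ G.map (ρ_ c).hom) ≫ μ G (𝟙_ C) c ≫ G.map (λ_ c).hom
    rw [comp_whiskerRight, Category.assoc, μ_natural_left_assoc, whiskerLeft_comp,
      Category.assoc, μ_natural_right_assoc, ← associativity_assoc, ← G.map_comp, ← G.map_comp,
      ← G.map_comp]
    congr 3
    monoidal

/-- The bimodule morphism `G c ⟶ G d` underlying `G f`. -/
abbrev canonicalMap (G : C ⥤ M) [G.LaxMonoidal] {c d : C} (f : c ⟶ d) :
    canonicalObj G c ⟶ canonicalObj G d where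
  hom := G.map f
  left_act_hom := by
    change (μ G (𝟙_ C) c ≫ G.map (λ_ c).hom) ≫ G.map f =
      G.obj (𝟙_ C) ◁ G.map f ≫ μ G (𝟙_ C) d ≫ G.map (λ_ d).hom
    rw [Category.assoc, μ_natural_right_assoc, ← G.map_comp, ← G.map_comp,
      MonoidalCategory.leftUnitor_naturality]
  right_act_hom := by
    change (μ G c (𝟙_ C) ≫ G.map (ρ_ c).hom) ≫ G.map f =
      G.map f ▷ G.obj (𝟙_ C) ≫ μ G d (𝟙_ C) ≫ G.map (ρ_ d).hom
    rw [Category.assoc, μ_natural_left_assoc, ← G.map_comp, ← G.map_comp,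
      MonoidalCategory.rightUnitor_naturality]

/-- The functor `U : C ⥤ _R M_R` of the canonical factorization `G = Γ U`. -/
@[simps]
def canonicalFunctor (G : C ⥤ M) [G.LaxMonoidal] :
    C ⥤ Bimod (baseMonoid G) (baseMonoid G) where
  obj c := canonicalObj G c
  map f := canonicalMap G f
  map_id c := Bimod.hom_ext _ _ (G.map_id c)
  map_comp f g := Bimod.hom_ext _ _ (G.map_comp f g)

variable [HasCoequalizers M]
variable [∀ X : M, PreservesColimitsOfShape WalkingParallelPair (tensorLeft X)]
variable [∀ X : M, PreservesColimitsOfShape WalkingParallelPair (tensorRight X)]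

/-- The arrow `G a ⊗_R G b ⟶ G (a ⊗ b)` through which `G_{a,b}` factors. -/
def canonicalMu (G : C ⥤ M) [G.LaxMonoidal] (a b : C) :
    obj (canonicalObj G a) (canonicalObj G b) ⟶ G.obj (a ⊗ b) :=
  desc (μ G a b) (by
    change (μ G a (𝟙_ C) ≫ G.map (ρ_ a).hom) ▷ G.obj b ≫ μ G a b =
      (α_ (G.obj a) (G.obj (𝟙_ C)) (G.obj b)).hom ≫
        G.obj a ◁ (μ G (𝟙_ C) b ≫ G.map (λ_ b).hom) ≫ μ G a b
    rw [comp_whiskerRight, Category.assoc, μ_natural_left, whiskerLeft_comp,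
      Category.assoc, μ_natural_right, ← associativity_assoc, ← G.map_comp,
      MonoidalCategory.triangle])

@[simp] lemma proj_canonicalMu (G : C ⥤ M) [G.LaxMonoidal] (a b : C) :
    proj (canonicalObj G a) (canonicalObj G b) ≫ canonicalMu G a b =
      μ G a b :=
  proj_desc _ _

@[simp] lemma proj_canonicalMu_assoc (G : C ⥤ M) [G.LaxMonoidal] (a b : C) {Z : M}
    (h : G.obj (a ⊗ b) ⟶ Z) :
    proj (canonicalObj G a) (canonicalObj G b) ≫ canonicalMu G a b ≫ h = μ G a b ≫ h :=
  proj_desc_assoc _ _ _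

/-- The unit arrow `U_0 : R ⟶ U e`, whose underlying arrow is an identity. -/
abbrev canonicalUnitHom (G : C ⥤ M) [G.LaxMonoidal] :
    unit (baseMonoid G) ⟶ canonicalObj G (𝟙_ C) where
  hom := 𝟙 (G.obj (𝟙_ C))
  left_act_hom := by
    change (μ G (𝟙_ C) (𝟙_ C) ≫ G.map (λ_ (𝟙_ C)).hom) ≫ 𝟙 (G.obj (𝟙_ C)) =
      G.obj (𝟙_ C) ◁ 𝟙 (G.obj (𝟙_ C)) ≫ μ G (𝟙_ C) (𝟙_ C) ≫ G.map (λ_ (𝟙_ C)).hom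
    rw [whiskerLeft_id, Category.id_comp, Category.comp_id]
  right_act_hom := by
    change (μ G (𝟙_ C) (𝟙_ C) ≫ G.map (λ_ (𝟙_ C)).hom) ≫ 𝟙 (G.obj (𝟙_ C)) =
      𝟙 (G.obj (𝟙_ C)) ▷ G.obj (𝟙_ C) ≫ μ G (𝟙_ C) (𝟙_ C) ≫ G.map (ρ_ (𝟙_ C)).hom
    rw [id_whiskerRight, Category.id_comp, Category.comp_id, unitors_equal]

/-- The arrow `U_{a,b} : U a ⊗_R U b ⟶ U (a ⊗ b)`. -/
abbrev canonicalMuHom (G : C ⥤ M) [G.LaxMonoidal] (a b : C) :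
    tensor (canonicalObj G a) (canonicalObj G b) ⟶ canonicalObj G (a ⊗ b) where
  hom := canonicalMu G a b
  left_act_hom := by
    change actLeft (canonicalObj G a) (canonicalObj G b) ≫ canonicalMu G a b =
      G.obj (𝟙_ C) ◁ canonicalMu G a b ≫ μ G (𝟙_ C) (a ⊗ b) ≫ G.map (λ_ (a ⊗ b)).hom
    rw [← cancel_epi (G.obj (𝟙_ C) ◁ proj (canonicalObj G a) (canonicalObj G b)),
      whiskerLeft_proj_actLeft_assoc (canonicalObj G a) (canonicalObj G b), proj_canonicalMu,
      ← whiskerLeft_comp_assoc,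
      proj_canonicalMu,
      ← cancel_epi (α_ (G.obj (𝟙_ C)) (G.obj a) (G.obj b)).hom, Iso.hom_inv_id_assoc,
      comp_whiskerRight, Category.assoc, μ_natural_left, ← associativity_assoc, ← G.map_comp]
    congr 3
    monoidal
  right_act_hom := by
    change actRight (canonicalObj G a) (canonicalObj G b) ≫ canonicalMu G a b =
      canonicalMu G a b ▷ G.obj (𝟙_ C) ≫ μ G (a ⊗ b) (𝟙_ C) ≫ G.map (ρ_ (a ⊗ b)).hom
    rw [← cancel_epi (proj (canonicalObj G a) (canonicalObj G b) ▷ G.obj (𝟙_ C)),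
      proj_whiskerRight_actRight_assoc, proj_canonicalMu, ← comp_whiskerRight_assoc,
      proj_canonicalMu, whiskerLeft_comp, Category.assoc, μ_natural_right,
      ← associativity_assoc, ← G.map_comp]
    congr 3
    monoidal

/-- The monoidal structure of `U`; it is strictly unital. -/
instance canonicalFunctorLaxMonoidal (G : C ⥤ M) [G.LaxMonoidal] :
    (canonicalFunctor G).LaxMonoidal where
  ε := canonicalUnitHom G
  μ a b := canonicalMuHom G a b
  μ_natural_left {a b} f c := by
    apply Bimod.hom_ext
    apply hom_ext
    change proj (canonicalObj G a) (canonicalObj G c) ≫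
        map (canonicalMap G f) (𝟙 (canonicalObj G c)) ≫ canonicalMu G b c =
      proj (canonicalObj G a) (canonicalObj G c) ≫ canonicalMu G a c ≫ G.map (f ▷ c)
    rw [proj_map_assoc, proj_canonicalMu, proj_canonicalMu_assoc, ← μ_natural_left,
      ← tensorHom_id]
    rfl
  μ_natural_right {a b} c f := by
    apply Bimod.hom_ext
    apply hom_ext
    change proj (canonicalObj G c) (canonicalObj G a) ≫
        map (𝟙 (canonicalObj G c)) (canonicalMap G f) ≫ canonicalMu G c b =
      proj (canonicalObj G c) (canonicalObj G a) ≫ canonicalMu G c a ≫ G.map (c ◁ f)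
    rw [proj_map_assoc, proj_canonicalMu, proj_canonicalMu_assoc, ← μ_natural_right,
      ← id_tensorHom]
    rfl
  associativity a b c := by
    apply Bimod.hom_ext
    apply hom_ext₃
    change proj (canonicalObj G a) (canonicalObj G b) ▷ G.obj c ≫
        proj (tensor (canonicalObj G a) (canonicalObj G b)) (canonicalObj G c) ≫
          map (canonicalMuHom G a b) (𝟙 (canonicalObj G c)) ≫
            canonicalMu G (a ⊗ b) c ≫ G.map (α_ a b c).hom =
      proj (canonicalObj G a) (canonicalObj G b) ▷ G.obj c ≫
        proj (tensor (canonicalObj G a) (canonicalObj G b)) (canonicalObj G c) ≫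
          assocHom (canonicalObj G a) (canonicalObj G b) (canonicalObj G c) ≫
            map (𝟙 (canonicalObj G a)) (canonicalMuHom G b c) ≫ canonicalMu G a (b ⊗ c)
    rw [proj_map_assoc, proj_canonicalMu_assoc,
      proj_proj_assocHom_assoc (canonicalObj G a) (canonicalObj G b) (canonicalObj G c),
      proj_map_assoc,
      proj_canonicalMu, Bimod.id_hom', Bimod.id_hom', tensorHom_id, id_tensorHom,
      ← comp_whiskerRight_assoc, proj_canonicalMu, ← whiskerLeft_comp_assoc, proj_canonicalMu,
      associativity]
  left_unitality a := by
    apply Bimod.hom_ext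
    apply hom_ext
    change proj (unit (baseMonoid G)) (canonicalObj G a) ≫ leftUnitorHom (canonicalObj G a) =
      proj (unit (baseMonoid G)) (canonicalObj G a) ≫
        map (canonicalUnitHom G) (𝟙 (canonicalObj G a)) ≫
          canonicalMu G (𝟙_ C) a ≫ G.map (λ_ a).hom
    rw [proj_leftUnitorHom, proj_map_assoc, proj_canonicalMu_assoc, Bimod.id_hom',
      id_tensorHom_id, Category.id_comp]
  right_unitality a := by
    apply Bimod.hom_ext
    apply hom_ext
    change proj (canonicalObj G a) (unit (baseMonoid G)) ≫ rightUnitorHom (canonicalObj G a) =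
      proj (canonicalObj G a) (unit (baseMonoid G)) ≫
        map (𝟙 (canonicalObj G a)) (canonicalUnitHom G) ≫
          canonicalMu G a (𝟙_ C) ≫ G.map (ρ_ a).hom
    rw [proj_rightUnitorHom, proj_map_assoc, proj_canonicalMu_assoc, Bimod.id_hom',
      id_tensorHom_id, Category.id_comp]

/-- `G` is essentially strong monoidal if the functor `U` of its canonical factorization is strong
monoidal, i.e. all its structure arrows `U_0` and `U_{a,b}` are isomorphisms. -/
def EssentiallyStrongMonoidal (G : C ⥤ M) [G.LaxMonoidal] : Prop :=
  IsIso (ε (canonicalFunctor G)) ∧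
    ∀ a b : C, IsIso (μ (canonicalFunctor G) a b)

end CanonicalFactorization

section OpmonoidalMonad

open Functor.OplaxMonoidal

variable {D : Type u₂} [Category.{v} D] [MonoidalCategory D]

/-- An opmonoidal monad (bimonad): a monad `T` whose underlying functor is opmonoidal and whose
unit and multiplication are opmonoidal natural transformations `𝟭 ⟶ T` and `T ∘ T ⟶ T`. -/
class OpmonoidalMonad (T : Monad D) extends T.toFunctor.OplaxMonoidal where
  unit_counit : T.η.app (𝟙_ D) ≫ η = 𝟙 (𝟙_ D)
  unit_comul (X Y : D) :
    T.η.app (X ⊗ Y) ≫ δ X Y = T.η.app X ⊗ₘ T.η.app Y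
  mul_counit : T.μ.app (𝟙_ D) ≫ η = T.map (η) ≫ η
  mul_comul (X Y : D) :
    T.μ.app (X ⊗ Y) ≫ δ X Y =
      T.map (δ X Y) ≫ δ (T.obj X) (T.obj Y) ≫
        (T.μ.app X ⊗ₘ T.μ.app Y)

variable (T : Monad D) [OpmonoidalMonad T]

namespace OpmonoidalMonad

/-- The tensor product of two `T`-algebras, with action `T (x ⊗ y) ⟶ T x ⊗ T y ⟶ x ⊗ y`. -/
abbrev tensorAlgebra (A B : T.Algebra) : T.Algebra where
  A := A.A ⊗ B.A
  a := δ T.toFunctor A.A B.A ≫ (A.a ⊗ₘ B.a)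
  unit := by
    rw [← Category.assoc, unit_comul, MonoidalCategory.tensorHom_comp_tensorHom, A.unit, B.unit]
    exact MonoidalCategory.id_tensorHom_id A.A B.A
  assoc := by
    rw [← Category.assoc, mul_comul, Category.assoc, Category.assoc,
      MonoidalCategory.tensorHom_comp_tensorHom, A.assoc, B.assoc,
      ← MonoidalCategory.tensorHom_comp_tensorHom, δ_natural_assoc, Functor.map_comp,
      Category.assoc]

/-- The unit object with the `T`-algebra structure given by the counit `T e ⟶ e`. -/
abbrev unitAlgebra : T.Algebra where
  A := 𝟙_ D
  a := η T.toFunctor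
  unit := unit_counit
  assoc := mul_counit

/-- The tensor product of two morphisms of `T`-algebras. -/
abbrev tensorAlgebraHom {A A' B B' : T.Algebra} (f : A ⟶ A') (g : B ⟶ B') :
    tensorAlgebra T A B ⟶ tensorAlgebra T A' B' where
  f := f.f ⊗ₘ g.f
  h := by
    rw [← δ_natural_assoc, Category.assoc, MonoidalCategory.tensorHom_comp_tensorHom,
      MonoidalCategory.tensorHom_comp_tensorHom, f.h, g.h]

instance : MonoidalCategoryStruct T.Algebra where
  tensorObj A B := tensorAlgebra T A B
  whiskerLeft A B B' g :=
    { f := A.A ◁ g.f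
      h := by simpa only [Monad.Algebra.id_f, id_tensorHom] using (tensorAlgebraHom T (𝟙 A) g).h }
  whiskerRight {A A'} f B :=
    { f := f.f ▷ B.A
      h := by simpa only [Monad.Algebra.id_f, tensorHom_id] using (tensorAlgebraHom T f (𝟙 B)).h }
  tensorHom f g := tensorAlgebraHom T f g
  tensorUnit := unitAlgebra T
  associator A B E := Monad.Algebra.isoMk (α_ A.A B.A E.A) (by
    change T.map (α_ A.A B.A E.A).hom ≫
        δ T.toFunctor A.A (B.A ⊗ E.A) ≫ (A.a ⊗ₘ (δ T.toFunctor B.A E.A ≫ (B.a ⊗ₘ E.a))) =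
      (δ T.toFunctor (A.A ⊗ B.A) E.A ≫ ((δ T.toFunctor A.A B.A ≫ (A.a ⊗ₘ B.a)) ⊗ₘ E.a)) ≫
        (α_ A.A B.A E.A).hom
    have h := oplax_associativity T.toFunctor A.A B.A E.A
    have h₁ : A.a ⊗ₘ (δ T.toFunctor B.A E.A ≫ (B.a ⊗ₘ E.a)) =
        T.obj A.A ◁ δ T.toFunctor B.A E.A ≫ (A.a ⊗ₘ (B.a ⊗ₘ E.a)) := by
      rw [← id_tensorHom, MonoidalCategory.tensorHom_comp_tensorHom, Category.id_comp]
    have h₂ : (δ T.toFunctor A.A B.A ≫ (A.a ⊗ₘ B.a)) ⊗ₘ E.a =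
        δ T.toFunctor A.A B.A ▷ T.obj E.A ≫ ((A.a ⊗ₘ B.a) ⊗ₘ E.a) := by
      rw [← tensorHom_id, MonoidalCategory.tensorHom_comp_tensorHom, Category.id_comp]
    rw [h₁, h₂, Category.assoc, Category.assoc, MonoidalCategory.associator_naturality]
    simpa only [Category.assoc] using (h =≫ (A.a ⊗ₘ (B.a ⊗ₘ E.a))).symm)
  leftUnitor A := Monad.Algebra.isoMk (λ_ A.A) (by
    change T.map (λ_ A.A).hom ≫ A.a =
      (δ T.toFunctor (𝟙_ D) A.A ≫ (η T.toFunctor ⊗ₘ A.a)) ≫ (λ_ A.A).hom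
    rw [MonoidalCategory.tensorHom_def, Category.assoc, Category.assoc,
      MonoidalCategory.leftUnitor_naturality, Functor.OplaxMonoidal.left_unitality_hom_assoc])
  rightUnitor A := Monad.Algebra.isoMk (ρ_ A.A) (by
    change T.map (ρ_ A.A).hom ≫ A.a =
      (δ T.toFunctor A.A (𝟙_ D) ≫ (A.a ⊗ₘ η T.toFunctor)) ≫ (ρ_ A.A).hom
    rw [MonoidalCategory.tensorHom_def', Category.assoc, Category.assoc,
      MonoidalCategory.rightUnitor_naturality, Functor.OplaxMonoidal.right_unitality_hom_assoc])

/-- The monoidal structure on the Eilenberg–Moore category of an opmonoidal monad. -/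
instance monoidalAlgebra : MonoidalCategory T.Algebra where
  tensorHom_def f g := by ext; exact MonoidalCategory.tensorHom_def f.f g.f
  id_tensorHom_id A B := by ext; exact MonoidalCategory.id_tensorHom_id A.A B.A
  tensorHom_comp_tensorHom f₁ f₂ g₁ g₂ := by
    ext; exact MonoidalCategory.tensorHom_comp_tensorHom f₁.f f₂.f g₁.f g₂.f
  whiskerLeft_id A B := by ext; exact MonoidalCategory.whiskerLeft_id A.A B.A
  id_whiskerRight A B := by ext; exact MonoidalCategory.id_whiskerRight A.A B.A
  associator_naturality f₁ f₂ f₃ := by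
    ext; exact MonoidalCategory.associator_naturality f₁.f f₂.f f₃.f
  leftUnitor_naturality f := by ext; exact MonoidalCategory.leftUnitor_naturality f.f
  rightUnitor_naturality f := by ext; exact MonoidalCategory.rightUnitor_naturality f.f
  pentagon A B E F := by ext; exact MonoidalCategory.pentagon A.A B.A E.A F.A
  triangle A B := by ext; exact MonoidalCategory.triangle A.A B.A

/-- The forgetful functor `U^T` of `T`-algebras is strict monoidal: its structure arrows are
identities. -/
instance forgetMonoidal : T.forget.Monoidal where
  ε := 𝟙 (𝟙_ D)
  μ A B := 𝟙 (A.A ⊗ B.A)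
  η := 𝟙 (𝟙_ D)
  δ A B := 𝟙 (A.A ⊗ B.A)
  μ_natural_left f X := (Category.comp_id _).trans (Category.id_comp _).symm
  μ_natural_right X f := (Category.comp_id _).trans (Category.id_comp _).symm
  associativity A B E := by
    change 𝟙 (A.A ⊗ B.A) ▷ E.A ≫ 𝟙 ((A.A ⊗ B.A) ⊗ E.A) ≫ (α_ A.A B.A E.A).hom =
      (α_ A.A B.A E.A).hom ≫ A.A ◁ 𝟙 (B.A ⊗ E.A) ≫ 𝟙 (A.A ⊗ B.A ⊗ E.A)
    simp
  left_unitality A := by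
    change (λ_ A.A).hom = 𝟙 (𝟙_ D) ▷ A.A ≫ 𝟙 (𝟙_ D ⊗ A.A) ≫ (λ_ A.A).hom
    simp
  right_unitality A := by
    change (ρ_ A.A).hom = A.A ◁ 𝟙 (𝟙_ D) ≫ 𝟙 (A.A ⊗ 𝟙_ D) ≫ (ρ_ A.A).hom
    simp
  δ_natural_left f X := (Category.id_comp _).trans (Category.comp_id _).symm
  δ_natural_right X f := (Category.id_comp _).trans (Category.comp_id _).symm
  oplax_associativity A B E := by
    change 𝟙 ((A.A ⊗ B.A) ⊗ E.A) ≫ 𝟙 (A.A ⊗ B.A) ▷ E.A ≫ (α_ A.A B.A E.A).hom =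
      (α_ A.A B.A E.A).hom ≫ 𝟙 (A.A ⊗ B.A ⊗ E.A) ≫ A.A ◁ 𝟙 (B.A ⊗ E.A)
    simp
  oplax_left_unitality A := by
    change (λ_ A.A).inv = (λ_ A.A).inv ≫ 𝟙 (𝟙_ D ⊗ A.A) ≫ 𝟙 (𝟙_ D) ▷ A.A
    simp
  oplax_right_unitality A := by
    change (ρ_ A.A).inv = (ρ_ A.A).inv ≫ 𝟙 (A.A ⊗ 𝟙_ D) ≫ A.A ◁ 𝟙 (𝟙_ D)
    simp
  ε_η := Category.comp_id _
  η_ε := Category.comp_id _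
  μ_δ _ _ := Category.comp_id _
  δ_μ _ _ := Category.comp_id _

end OpmonoidalMonad

end OpmonoidalMonad

end

/-! The left adjoint of `U` comes from the special adjoint functor theorem. Since `G = Γ U` is a
right adjoint, it preserves limits. The forgetful functor `Γ` reflects them: whether an arrow into a
limit respects the actions can be tested on the limit projections (`reflectsLimit_bimodForget`).
Hence `U` preserves limits (`preservesLimits_canonicalFunctor`), and completeness, well-poweredness
and a small coseparating set in `C` yield `F ⊣ U`.

The rest is doctrinal adjunction. A lax monoidal structure on `U` corresponds, by taking mates, to
an opmonoidal structure on `F`. If `U` is strong, its inverse structure arrows make it opmonoidal as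
well, so `T = UF` is a composite of opmonoidal functors. The mate identities make the unit and the
multiplication of `T` opmonoidal (`opmonoidalMonadOfAdjunction`). They also say that `U_0` and
`U_{a,b}` commute with the `T`-actions, so the same isomorphisms serve as the structure of `K`
(`comparisonMonoidal`).

Finally, `U^T K = U` holds on the nose and `U^T` is strict, so the structure arrows of `Γ U^T K` are
those of `Γ U`. These are the arrows of `G`: `G_{a,b}` is the coequalizer projection followed by
`U_{a,b}`, and `G_0` is the unit of `R`. -/

/-! ### Limits of bimodules and existence of the left adjoint. -/

section ReflectsLimits

variable {M : Type u₂} [Category.{v} M] [MonoidalCategory M]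

/-- A cone of bimodules is a limit cone if its underlying cone in `M` is one. -/
lemma reflectsLimit_bimodForget (R : Mon M) {J : Type*} [Category J] (K : J ⥤ Bimod R R) :
    ReflectsLimit K (Bimod.forget R) where
  reflects {c} hc := by
    let l (s : Cone K) : s.pt.X ⟶ c.pt.X := hc.lift ((Bimod.forget R).mapCone s)
    have fac (s : Cone K) (j : J) : l s ≫ (c.π.app j).hom = (s.π.app j).hom :=
      hc.fac ((Bimod.forget R).mapCone s) j
    -- The source `Z` will be `R ⊗ s.pt` or `s.pt ⊗ R`. Tensoring with `R` affects only sources, so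
    -- it need not preserve limits.
    have ext {Z : M} {f g : Z ⟶ c.pt.X}
        (h : ∀ j, f ≫ (c.π.app j).hom = g ≫ (c.π.app j).hom) : f = g := hc.hom_ext h
    refine ⟨{
      lift := fun s => {
        hom := l s
        left_act_hom := ext fun j => ?_
        right_act_hom := ext fun j => ?_ }
      fac := fun s j => Bimod.hom_ext _ _ (fac s j)
      uniq := fun s m hm => Bimod.hom_ext _ _ <|
        hc.uniq ((Bimod.forget R).mapCone s) m.hom fun j => congrArg Bimod.Hom.hom (hm j) }⟩
    -- After projection to `K.obj j`, both sides become `R ◁ (s.π.app j).hom` followed by the action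
    -- on `K.obj j`, because the legs of both cones are bimodule morphisms.
    · have h₁ := Bimod.Hom.left_act_hom (s.π.app j)
      have h₂ := Bimod.Hom.left_act_hom (c.π.app j)
      dsimp at h₁ h₂
      rw [Category.assoc, Category.assoc, fac, h₁, h₂, ← whiskerLeft_comp_assoc, fac]
    · have h₁ := Bimod.Hom.right_act_hom (s.π.app j)
      have h₂ := Bimod.Hom.right_act_hom (c.π.app j)
      dsimp at h₁ h₂
      rw [Category.assoc, Category.assoc, fac, h₁, h₂, ← comp_whiskerRight_assoc, fac]

variable {C : Type u₁} [Category.{v} C] [MonoidalCategory C]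

/-- The functor `U` of the canonical factorization preserves all limits that `G` preserves. -/
lemma preservesLimits_canonicalFunctor (G : C ⥤ M) [G.LaxMonoidal] [PreservesLimits G] :
    PreservesLimits (canonicalFunctor G) := by
  have : ReflectsLimits (Bimod.forget (baseMonoid G)) :=
    ⟨⟨fun {K} => reflectsLimit_bimodForget _ K⟩⟩
  -- `Γ U` is `G` by definition, so no transport along an isomorphism is needed.
  have : PreservesLimits (canonicalFunctor G ⋙ Bimod.forget (baseMonoid G)) :=
    inferInstanceAs (PreservesLimits G)
  exact preservesLimits_of_reflects_of_preserves _ (Bimod.forget (baseMonoid G))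

/-- The functor `U` of the canonical factorization of a right adjoint `G` has a left adjoint. -/
lemma isRightAdjoint_canonicalFunctor [HasLimits C] [WellPowered.{v} C]
    {P : ObjectProperty C} [ObjectProperty.Small.{v} P] (hP : P.IsCoseparating)
    (G : C ⥤ M) [G.LaxMonoidal] [G.IsRightAdjoint] : (canonicalFunctor G).IsRightAdjoint :=
  have : PreservesLimits G := (Adjunction.ofIsRightAdjoint G).rightAdjoint_preservesLimits
  have := preservesLimits_canonicalFunctor G
  -- Special adjoint functor theorem. All its completeness and smallness conditions concern `C`; the
  -- category of bimodules only has to be locally small.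
  isRightAdjoint_of_preservesLimits_of_isCoseparating hP _

end ReflectsLimits

/-! ### Doctrinal adjunction: the opmonoidal monad and the strong monoidal comparison functor. -/

section MonoidalAdjunction

open Functor.OplaxMonoidal Functor.LaxMonoidal

variable {C : Type u₁} [Category.{v} C] [MonoidalCategory C]
variable {D : Type u₂} [Category.{v} D] [MonoidalCategory D]
variable {F : D ⥤ C} {U : C ⥤ D} (adj : F ⊣ U) [F.OplaxMonoidal] [U.Monoidal] [adj.IsMonoidal]

/-- The monad of an adjunction with opmonoidal left adjoint and strong monoidal right adjoint is
opmonoidal. -/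
abbrev opmonoidalMonadOfAdjunction : OpmonoidalMonad adj.toMonad where
  toOplaxMonoidal := inferInstanceAs (F ⋙ U).OplaxMonoidal
  unit_counit := by
    -- The first two arrows compose to the mate of `η F`, which is `ε U`; strength of `U` makes `η
    -- U` its inverse. The next field is the same argument with `δ F` and `μ U`.
    change adj.unit.app (𝟙_ D) ≫ U.map (η F) ≫ η U = _
    rw [adj.unit_app_unit_comp_map_η_assoc, Functor.Monoidal.ε_η]
  unit_comul X Y := by
    change adj.unit.app (X ⊗ Y) ≫ U.map (δ F X Y) ≫ δ U _ _ = _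
    rw [adj.unit_app_tensor_comp_map_δ_assoc, Functor.Monoidal.μ_δ, Category.comp_id]
    rfl
  mul_counit := by
    change U.map (adj.counit.app (F.obj (𝟙_ D))) ≫ U.map (η F) ≫ η U =
      U.map (F.map (U.map (η F) ≫ η U)) ≫ U.map (η F) ≫ η U
    -- The multiplication of the monad is `U` of a counit, so the identity can be proved in `C` and
    -- then mapped by `U`. Writing the outer `η F` as `F (ε U)` followed by the counit cancels `η U`
    -- against `ε U` and leaves naturality of the counit. The initial rewrite expands every `η F`;
    -- the last one folds back those left over.
    have h : adj.counit.app (F.obj (𝟙_ D)) ≫ η F = F.map (U.map (η F) ≫ η U) ≫ η F := by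
      rw [← adj.map_ε_comp_counit_app_unit, ← F.map_comp_assoc, Category.assoc,
        Functor.Monoidal.η_ε, Category.comp_id, adj.map_ε_comp_counit_app_unit]
      exact (adj.counit_naturality (η F)).symm
    rw [← U.map_comp_assoc, ← U.map_comp_assoc, h]
  mul_comul X Y := by
    change U.map (adj.counit.app (F.obj (X ⊗ Y))) ≫ U.map (δ F X Y) ≫ δ U _ _ =
      U.map (F.map (U.map (δ F X Y) ≫ δ U _ _)) ≫ (U.map (δ F _ _) ≫ δ U _ _) ≫
        (U.map (adj.counit.app (F.obj X)) ⊗ₘ U.map (adj.counit.app (F.obj Y)))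
    -- The binary analogue: `δ F` followed by two counits is `F (μ U)` followed by one counit, after
    -- which `δ U` cancels and naturality of the counit remains.
    have h : adj.counit.app (F.obj (X ⊗ Y)) ≫ δ F X Y = F.map (U.map (δ F X Y) ≫ δ U _ _) ≫
        δ F _ _ ≫ (adj.counit.app (F.obj X) ⊗ₘ adj.counit.app (F.obj Y)) := by
      rw [← adj.map_μ_comp_counit_app_tensor, ← F.map_comp_assoc, Category.assoc,
        Functor.Monoidal.δ_μ, Category.comp_id]
      exact (adj.counit_naturality (δ F X Y)).symm
    -- Brings the two counits inside `U`, so that everything before the final `δ U` is the image of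
    -- `h`.
    have h' := δ_natural U (adj.counit.app (F.obj X)) (adj.counit.app (F.obj Y))
    dsimp at h'
    rw [Category.assoc, h', ← U.map_comp_assoc, h]
    simp only [U.map_comp, Category.assoc]

/-- The comparison functor of an adjunction with opmonoidal left adjoint and strong monoidal right
adjoint is strong monoidal, with the structure arrows of the right adjoint. -/
abbrev comparisonMonoidal :
    letI := opmonoidalMonadOfAdjunction adj
    (Monad.comparison adj).Monoidal :=
  letI := opmonoidalMonadOfAdjunction adj
  Functor.CoreMonoidal.toMonoidal
    { εIso := Monad.Algebra.isoMk (Functor.Monoidal.εIso U) (by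
        -- Compatibility of `U_0` with the actions: the right side collapses to `U (η F)`, and the
        -- mate identity turns the left side into the same arrow.
        change U.map (F.map (ε U)) ≫ U.map (adj.counit.app (𝟙_ C)) = (U.map (η F) ≫ η U) ≫ ε U
        rw [← U.map_comp, adj.map_ε_comp_counit_app_unit, Category.assoc,
          Functor.Monoidal.η_ε, Category.comp_id])
      μIso := fun X Y => Monad.Algebra.isoMk (Functor.Monoidal.μIso U X Y) (by
        change U.map (F.map (μ U X Y)) ≫ U.map (adj.counit.app (X ⊗ Y)) =
          ((U.map (δ F _ _) ≫ δ U _ _) ≫ (U.map (adj.counit.app X) ⊗ₘ U.map (adj.counit.app Y))) ≫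
            μ U X Y
        have h := μ_natural U (adj.counit.app X) (adj.counit.app Y)
        dsimp at h
        rw [← U.map_comp, adj.map_μ_comp_counit_app_tensor, Category.assoc, Category.assoc, h,
          Functor.Monoidal.δ_μ_assoc, U.map_comp])
      -- The forgetful functor from algebras is faithful and strict, so each coherence law for `K`
      -- is literally the corresponding law for `U`.
      μIso_hom_natural_left := fun f X => Monad.Algebra.Hom.ext (μ_natural_left U f X)
      μIso_hom_natural_right := fun X f => Monad.Algebra.Hom.ext (μ_natural_right U X f)
      associativity := fun X Y Z => Monad.Algebra.Hom.ext (associativity U X Y Z)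
      left_unitality := fun X => Monad.Algebra.Hom.ext (left_unitality U X)
      right_unitality := fun X => Monad.Algebra.Hom.ext (right_unitality U X) }

end MonoidalAdjunction

/-! ### Comparison of the structure arrows and assembly of the theorem. -/

/-- Two monoidal structures on a functor with the same structure arrows agree. -/
lemma laxMonoidalFunctor_of_eq {C : Type*} [Category C] [MonoidalCategory C]
    {D : Type*} [Category D] [MonoidalCategory D] (F : C ⥤ D) (h₁ h₂ : F.LaxMonoidal)
    (hε : h₁.ε = h₂.ε) (hμ : ∀ X Y, h₁.μ X Y = h₂.μ X Y) :
    @LaxMonoidalFunctor.of _ _ _ _ _ _ F h₁ = @LaxMonoidalFunctor.of _ _ _ _ _ _ F h₂ := by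
  have : h₁ = h₂ := by
    cases h₁
    cases h₂
    -- `ε` and `μ` are the only data; once they are identified, the remaining fields agree by proof
    -- irrelevance.
    cases hε
    obtain rfl := funext fun X => funext (hμ X)
    rfl
  rw [this]

/-- Equality of bundled lax monoidal functors covers the underlying functor and both structure
arrows at once. The opmonoidal structure on the monad is quantified before that of `K`, since it
determines the tensor product of algebras. -/
theorem mainTheorem2 {C : Type u₁} [Category.{v} C] [MonoidalCategory C]
    {M : Type u₂} [Category.{v} M] [MonoidalCategory M]
    [HasLimits C] [WellPowered.{v} C]
    (hC : ∃ P : ObjectProperty C, ObjectProperty.Small.{v} P ∧ P.IsCoseparating)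
    [HasCoequalizers M]
    [∀ X : M, PreservesColimitsOfShape WalkingParallelPair (tensorLeft X)]
    [∀ X : M, PreservesColimitsOfShape WalkingParallelPair (tensorRight X)]
    (G : C ⥤ M) [G.LaxMonoidal] (hG : EssentiallyStrongMonoidal G) (hadj : G.IsRightAdjoint) :
    ∃ (F : Bimod (baseMonoid G) (baseMonoid G) ⥤ C) (adj : F ⊣ canonicalFunctor G)
      (_ : OpmonoidalMonad adj.toMonad) (_ : (Monad.comparison adj).Monoidal),
      LaxMonoidalFunctor.of
          (Monad.comparison adj ⋙ adj.toMonad.forget ⋙ forgetBimod (baseMonoid G)) =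
        LaxMonoidalFunctor.of G := by
  obtain ⟨P, _, hP⟩ := hC
  have := isRightAdjoint_canonicalFunctor hP G
  have := hG.1
  have := hG.2
  let adj := Adjunction.ofIsRightAdjoint (canonicalFunctor G)
  -- Essential strength enters here: the two `IsIso` facts supply the inverses of `U_0` and
  -- `U_{a,b}`.
  let : (canonicalFunctor G).Monoidal := Functor.Monoidal.ofLaxMonoidal _
  -- The lax structure is named explicitly: mates are taken for the one inside the strong structure,
  -- against which `adj.IsMonoidal` is stated in `opmonoidalMonadOfAdjunction`.
  let := @Adjunction.leftAdjointOplaxMonoidal _ _ _ _ _ _ _ _ adj Functor.Monoidal.toLaxMonoidal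
  refine ⟨_, adj, opmonoidalMonadOfAdjunction adj, comparisonMonoidal adj, ?_⟩
  -- The composite functor unfolds to `G` definitionally, so both lax structures live on `G` and
  -- only their arrows have to be compared.
  refine laxMonoidalFunctor_of_eq G _ _ ?_ fun X Y => ?_
  · change (Functor.LaxMonoidal.ε G ≫ 𝟙 (G.obj (𝟙_ C))) ≫ 𝟙 (G.obj (𝟙_ C)) = _
    rw [Category.comp_id, Category.comp_id]
  · change (BimodTensor.proj (canonicalObj G X) (canonicalObj G Y) ≫ 𝟙 _) ≫ canonicalMu G X Y = _
    rw [Category.comp_id, proj_canonicalMu]
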